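/- Let $E$ and $F$ be (real) Banach lattices with $F$ Dedekind complete. A continuous linear operator $T:E\to F$ is called almost Dunford--Pettis if $\|Tx_n\|\to 0$ for every disjoint weakly null sequence $(x_n)$ in $E$, and almost weak Dunford--Pettis if $f_n(Tx_n)\to 0$ whenever $(f_n)$ is a weakly null sequence in $F'$ and $(x_n)$ is a disjoint weakly null sequence in $E$. Let $\mathcal P\subseteq \mathrm L(E,F)$ be either the space $\text{a-DP}(E,F)$ of all almost Dunford--Pettis operators or the space $\text{a-wDP}(E,F)$ of all almost weak Dunford--Pettis operators. Let $\text{r-}\mathcal P(E,F)$ be the space of all operators $T=T_1-T_2$ with $T_1,T_2\in\mathcal P$ positive, ordered by $S\le T$ iff $Sx\le Tx$ for all $x\in E_+$, and let $$\|T\|_{\text{r-}\mathcal P}=\inf\{\|S\| : S\in\mathcal P,\ \pm T\le S\}\qquad (T\in\text{r-}\mathcal P(E,F))$$ be its enveloping norm. Then, in both cases, $\text{r-}\mathcal P(E,F)$ is a Banach lattice under the enveloping norm; that is, $\text{r-}\mathcal P(E,F)$ is a vector lattice, $\|\cdot\|_{\text{r-}\mathcal P}$ is a norm on it, $|S|\le|T|$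 implies $\|S\|_{\text{r-}\mathcal P}\le\|T\|_{\text{r-}\mathcal P}$, and $\text{r-}\mathcal P(E,F)$ is complete in this norm. -/

import Mathlib

open Filter Topology

noncomputable section

section Order

/-- Dedekind completeness of an ordered set: every nonempty set which is bounded above has a
supremum. -/
def IsDedekindComplete (F : Type*) [Preorder F] : Prop :=
  ∀ s : Set F, s.Nonempty → BddAbove s → ∃ a, IsLUB s a

/-- A sequence is disjoint if its terms are pairwise disjoint: `|xₘ| ∧ |xₙ| = 0` for `m ≠ n`. -/
def IsDisjointSeq {E : Type*} [Lattice E] [AddGroup E] (x : ℕ → E) : Prop :=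
  ∀ m n, m ≠ n → |x m| ⊓ |x n| = 0

end Order

/-- `N` is a norm making the ordered vector space `X` a Banach lattice: `X` is a vector lattice,
`N` is a norm on `X`, `N` is monotone with respect to the modulus `|S| = S ∨ (-S)`, and `X` is
complete with respect to `N`. -/
structure IsBanachLatticeNorm (X : Type*) [AddCommGroup X] [Module ℝ X] [PartialOrder X]
    (N : X → ℝ) : Prop where
  add_le_add : ∀ S T U : X, S ≤ T → S + U ≤ T + U
  smul_nonneg : ∀ (c : ℝ) (T : X), 0 ≤ c → 0 ≤ T → 0 ≤ c • T
  exists_sup : ∀ S T : X, ∃ U, IsLUB {S, T} U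
  exists_inf : ∀ S T : X, ∃ U, IsGLB {S, T} U
  nonneg : ∀ T : X, 0 ≤ N T
  eq_zero_iff : ∀ T : X, N T = 0 ↔ T = 0
  norm_add_le : ∀ S T : X, N (S + T) ≤ N S + N T
  norm_smul : ∀ (c : ℝ) (T : X), N (c • T) = |c| * N T
  solid : ∀ S T absS absT : X, IsLUB {S, -S} absS → IsLUB {T, -T} absT → absS ≤ absT → N S ≤ N T
  complete : ∀ u : ℕ → X,
    (∀ ε > 0, ∃ n₀, ∀ m ≥ n₀, ∀ n ≥ n₀, N (u m - u n) < ε) →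
      ∃ T, Tendsto (fun n => N (u n - T)) atTop (𝓝 0)

/-- A weakly null sequence in a normed space. -/
def IsWeaklyNull {E : Type*} [NormedAddCommGroup E] [NormedSpace ℝ E] (x : ℕ → E) : Prop :=
  ∀ f : StrongDual ℝ E, Tendsto (fun n => f (x n)) atTop (𝓝 0)

section Operators

variable {E F : Type*}
  [NormedAddCommGroup E] [NormedSpace ℝ E] [Lattice E]
  [NormedAddCommGroup F] [NormedSpace ℝ F]

variable (E F) in
/-- The space `a-DP(E, F)` of almost Dunford–Pettis operators: those taking disjoint weakly null
sequences to norm null ones. -/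
def almostDunfordPettis : Submodule ℝ (E →L[ℝ] F) where
  carrier := {T | ∀ x : ℕ → E, IsDisjointSeq x → IsWeaklyNull x →
    Tendsto (fun n => ‖T (x n)‖) atTop (𝓝 0)}
  zero_mem' := by
    intro x _ _
    simp
  add_mem' := by
    intro S T hS hT x hd hw
    have h1 := tendsto_zero_iff_norm_tendsto_zero.mpr (hS x hd hw)
    have h2 := tendsto_zero_iff_norm_tendsto_zero.mpr (hT x hd hw)
    simpa using (h1.add h2).norm
  smul_mem' := by
    intro c T hT x hd hw
    have h1 := tendsto_zero_iff_norm_tendsto_zero.mpr (hT x hd hw)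
    simpa using (h1.const_smul c).norm

variable (E F) in
/-- The space `a-wDP(E, F)` of almost weak Dunford–Pettis operators: `fₙ(T xₙ) → 0` whenever `(fₙ)`
is weakly null in `F'` and `(xₙ)` is disjoint and weakly null in `E`. -/
def almostWeakDunfordPettis : Submodule ℝ (E →L[ℝ] F) where
  carrier := {T | ∀ (f : ℕ → StrongDual ℝ F) (x : ℕ → E), IsWeaklyNull f →
    IsDisjointSeq x → IsWeaklyNull x → Tendsto (fun n => f n (T (x n))) atTop (𝓝 0)}
  zero_mem' := by
    intro f x _ _ _
    simp
  add_mem' := by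
    intro S T hS hT f x hf hd hw
    simpa using (hS f x hf hd hw).add (hT f x hf hd hw)
  smul_mem' := by
    intro c T hT f x hf hd hw
    simpa using (hT f x hf hd hw).const_mul c

variable [Lattice F]

/-- The operator order: `S ≤ T` iff `S x ≤ T x` for all `x ∈ E₊`. -/
def OpLE (S T : E →L[ℝ] F) : Prop := ∀ x : E, 0 ≤ x → S x ≤ T x

variable [IsOrderedAddMonoid F]

/-- The space `r-P(E, F)` of regularly `P`-operators: differences of two positive operators
from `P`. -/
def regularlyP (P : Submodule ℝ (E →L[ℝ] F)) [IsOrderedModule ℝ F] :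
    Submodule ℝ (E →L[ℝ] F) where
  carrier := {T | ∃ T₁ ∈ P, ∃ T₂ ∈ P, OpLE 0 T₁ ∧ OpLE 0 T₂ ∧ T = T₁ - T₂}
  zero_mem' := ⟨0, P.zero_mem, 0, P.zero_mem, fun _ _ => le_rfl, fun _ _ => le_rfl, by simp⟩
  add_mem' := by
    rintro _ _ ⟨A, hA, B, hB, hA0, hB0, rfl⟩ ⟨C, hC, D, hD, hC0, hD0, rfl⟩
    refine ⟨A + C, P.add_mem hA hC, B + D, P.add_mem hB hD, fun x hx => ?_, fun x hx => ?_,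
      by abel⟩
    · simpa using add_nonneg (hA0 x hx) (hC0 x hx)
    · simpa using add_nonneg (hB0 x hx) (hD0 x hx)
  smul_mem' := by
    rintro c _ ⟨A, hA, B, hB, hA0, hB0, rfl⟩
    rcases le_total 0 c with hc | hc
    · refine ⟨c • A, P.smul_mem c hA, c • B, P.smul_mem c hB, fun x hx => ?_, fun x hx => ?_,
        smul_sub c A B⟩
      · simpa using smul_nonneg hc (hA0 x hx)
      · simpa using smul_nonneg hc (hB0 x hx)
    · refine ⟨(-c) • B, P.smul_mem _ hB, (-c) • A, P.smul_mem _ hA, fun x hx => ?_,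
        fun x hx => ?_, by rw [smul_sub, neg_smul, neg_smul]; abel⟩
      · simpa only [smul_apply, zero_apply] using
          smul_nonneg (neg_nonneg.mpr hc) (hB0 x hx)
      · simpa only [smul_apply, zero_apply] using
          smul_nonneg (neg_nonneg.mpr hc) (hA0 x hx)

/-- `r-P(E, F)` is partially ordered by the operator order. -/
instance regularlyP.instPartialOrder [IsOrderedAddMonoid E] [IsOrderedModule ℝ F]
    (P : Submodule ℝ (E →L[ℝ] F)) : PartialOrder (regularlyP P) where
  le S T := OpLE (S : E →L[ℝ] F) (T : E →L[ℝ] F)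
  le_refl _ _ _ := le_rfl
  le_trans _ _ _ h₁ h₂ x hx := (h₁ x hx).trans (h₂ x hx)
  le_antisymm S T h₁ h₂ := by
    apply Subtype.ext
    ext x
    have h : ∀ y : E, 0 ≤ y → (S : E →L[ℝ] F) y = (T : E →L[ℝ] F) y :=
      fun y hy => le_antisymm (h₁ y hy) (h₂ y hy)
    rw [← posPart_sub_negPart x, map_sub, map_sub, h _ (posPart_nonneg x),
      h _ (negPart_nonneg x)]

/-- The enveloping norm `‖T‖_{r-P} = inf {‖S‖ : ±T ≤ S ∈ P}` on `r-P(E, F)`. -/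
def envelopingNorm [IsOrderedModule ℝ F] (P : Submodule ℝ (E →L[ℝ] F)) (T : regularlyP P) : ℝ :=
  sInf {r : ℝ | ∃ S ∈ P, OpLE (T : E →L[ℝ] F) S ∧ OpLE (-(T : E →L[ℝ] F)) S ∧ r = ‖S‖}

end Operators

end

/-!
Fix a space `P` of operators between Banach lattices `E` and `F`, with `F` Dedekind complete.
If `P` is norm closed and contains every positive operator dominated by a positive member of `P`,
then `r-P(E, F)` is a Banach lattice under the enveloping norm
(`isBanachLatticeNorm_envelopingNorm`). Indeed the Riesz–Kantorovich positive part of `T₁ - T₂` is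
dominated by `T₁`, hence lies in `P`, which gives the lattice operations; the norm is solid because
an operator dominates `±T` exactly when it dominates `|T|`; and a Cauchy sequence with summable
increments has dominating operators whose norm convergent tails dominate the distance to the limit
and stay in `P`.

Both spaces in question are closed because weakly null sequences are bounded. The content is the
domination property, and it rests on one fact (`IsWeaklyNull.of_disjoint_of_le_abs`): a positive
disjoint sequence `gₙ ≤ |fₙ|` with `fₙ` weakly null is itself weakly null. For a positive functional
`φ`, let `φₙ` be its component carried by `gₙ`; Hahn–Banach gives `ψₙ` with `|ψₙ x| ≤ φₙ |x|` and
`ψₙ fₙ ≥ φ gₙ`, and `∑ |ψₙ x| ≤ φ |x|`, so a sliding hump argument forces `ψₙ fₙ → 0`.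

In particular `|xₙ|` is weakly null when `xₙ` is disjoint and weakly null, and for `0 ≤ S ≤ T` the
estimate `|S xₙ| ≤ T |xₙ|` settles the almost Dunford–Pettis case. In the almost weak case one has
`|fₙ (S xₙ)| ≤ |fₙ| (T |xₙ|)`. Here `|fₙ|` need not be weakly null. But if the right-hand side did
not tend to zero, a subsequence of `|fₙ|` could be made disjoint without losing much of its values
on `T |xₙ|`, and the fact above, now applied in the Banach lattice `F'`, would contradict
the assumption on `T` (`tendsto_abs_apply_of_isWeaklyNull`).
-/

/-! ### The Riesz–Kantorovich construction -/

theorem abs_smul_le {X : Type*} [AddCommGroup X] [Module ℝ X] [Lattice X] [IsOrderedAddMonoid X]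
    [IsOrderedModule ℝ X] (c : ℝ) (x : X) : |c • x| ≤ |c| • |x| := by
  rw [abs_le']
  rcases le_total 0 c with hc | hc
  · rw [abs_of_nonneg hc, ← smul_neg]
    exact ⟨smul_le_smul_of_nonneg_left (le_abs_self x) hc,
      smul_le_smul_of_nonneg_left (neg_le_abs x) hc⟩
  · have hc' := neg_nonneg.mpr hc
    rw [abs_of_nonpos hc, ← neg_smul]
    refine ⟨?_, smul_le_smul_of_nonneg_left (le_abs_self x) hc'⟩
    rw [← neg_smul_neg]
    exact smul_le_smul_of_nonneg_left (neg_le_abs x) hc'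

section RieszKantorovich

open scoped Pointwise in
/-- The Riesz decomposition property: `[0, x + y] = [0, x] + [0, y]` in a lattice-ordered group. -/
theorem Icc_zero_add_Icc_zero {E : Type*} [AddCommGroup E] [Lattice E] [IsOrderedAddMonoid E]
    {x y : E} (hx : 0 ≤ x) (hy : 0 ≤ y) :
    Set.Icc 0 x + Set.Icc 0 y = Set.Icc 0 (x + y) := by
  ext z
  simp only [Set.mem_add, Set.mem_Icc]
  constructor
  · rintro ⟨a, ha, b, hb, rfl⟩
    exact ⟨add_nonneg ha.1 hb.1, add_le_add ha.2 hb.2⟩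
  · rintro ⟨hz0, hz⟩
    refine ⟨z ⊓ x, ⟨le_inf hz0 hx, inf_le_right⟩, z - z ⊓ x,
      ⟨sub_nonneg.mpr inf_le_left, ?_⟩, by abel⟩
    rw [sub_le_comm]
    exact le_inf (sub_le_self _ hy) (sub_le_iff_le_add.mpr hz)

variable {E F : Type*} [AddCommGroup E] [Module ℝ E] [Lattice E] [IsOrderedAddMonoid E]
  [AddCommGroup F] [Module ℝ F]

/-- An additive, positively homogeneous map on the positive cone of a vector lattice extends to a
linear map. -/
theorem exists_linearMap_eqOn_nonneg [IsOrderedModule ℝ E] (v : E → F)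
    (hadd : ∀ x y, 0 ≤ x → 0 ≤ y → v (x + y) = v x + v y)
    (hsmul : ∀ (c : ℝ) x, 0 ≤ c → 0 ≤ x → v (c • x) = c • v x) :
    ∃ V : E →ₗ[ℝ] F, ∀ x, 0 ≤ x → V x = v x := by
  -- the value `v a - v b` depends only on `a - b`
  have key : ∀ a b : E, 0 ≤ a → 0 ≤ b → v (a - b)⁺ - v (a - b)⁻ = v a - v b := by
    intro a b ha hb
    have h : (a - b)⁺ + b = a + (a - b)⁻ := by
      have := posPart_sub_negPart (a - b)
      rw [sub_eq_iff_eq_add] at this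
      rw [this]; abel
    have h' := congrArg v h
    rw [hadd _ _ (posPart_nonneg _) hb, hadd _ _ ha (negPart_nonneg _)] at h'
    rw [sub_eq_sub_iff_add_eq_add, h']
  have hv0 : v 0 = 0 := by simpa using hsmul 0 0 le_rfl le_rfl
  refine ⟨{ toFun := fun x => v x⁺ - v x⁻, map_add' := fun x y => ?_, map_smul' := fun c x => ?_ },
    fun x hx => ?_⟩
  · have h := key (x⁺ + y⁺) (x⁻ + y⁻) (add_nonneg (posPart_nonneg _) (posPart_nonneg _))
      (add_nonneg (negPart_nonneg _) (negPart_nonneg _))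
    rw [add_sub_add_comm, posPart_sub_negPart, posPart_sub_negPart,
      hadd _ _ (posPart_nonneg _) (posPart_nonneg _),
      hadd _ _ (negPart_nonneg _) (negPart_nonneg _)] at h
    rw [h, add_sub_add_comm]
  · rcases le_total 0 c with hc | hc
    · have h := key (c • x⁺) (c • x⁻) (smul_nonneg hc (posPart_nonneg _))
        (smul_nonneg hc (negPart_nonneg _))
      rw [← smul_sub, posPart_sub_negPart, hsmul _ _ hc (posPart_nonneg _),
        hsmul _ _ hc (negPart_nonneg _), ← smul_sub] at h
      simpa using h
    · have hc' : 0 ≤ -c := neg_nonneg.mpr hc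
      have h := key ((-c) • x⁻) ((-c) • x⁺) (smul_nonneg hc' (negPart_nonneg _))
        (smul_nonneg hc' (posPart_nonneg _))
      rw [← smul_sub, ← neg_sub x⁺, posPart_sub_negPart, smul_neg, neg_smul, neg_neg,
        hsmul _ _ hc' (posPart_nonneg _), hsmul _ _ hc' (negPart_nonneg _), ← smul_sub,
        neg_smul, ← smul_neg, neg_sub] at h
      simpa using h
  · simp [posPart_of_nonneg hx, negPart_of_nonneg hx, hv0]

variable [IsOrderedModule ℝ E] [Lattice F] [IsOrderedAddMonoid F] [IsOrderedModule ℝ F]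

open scoped Pointwise in
/-- The Riesz–Kantorovich formula: an order bounded linear map `U` into a Dedekind complete vector
lattice has a positive part, given on the positive cone by `x ↦ sup U [0, x]`. -/
theorem exists_isLUB_image_Icc (hF : IsDedekindComplete F) (U : E →ₗ[ℝ] F)
    (hb : ∀ x, 0 ≤ x → BddAbove (U '' Set.Icc 0 x)) :
    ∃ V : E →ₗ[ℝ] F, ∀ x, 0 ≤ x → IsLUB (U '' Set.Icc 0 x) (V x) := by
  have hex : ∀ x : E, ∃ a, IsLUB (U '' Set.Icc 0 |x|) a := fun x =>
    hF _ ⟨U 0, 0, ⟨le_rfl, abs_nonneg x⟩, rfl⟩ (hb _ (abs_nonneg x))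
  choose v hv using hex
  have hv' : ∀ x, 0 ≤ x → IsLUB (U '' Set.Icc 0 x) (v x) := fun x hx => by
    simpa only [abs_of_nonneg hx] using hv x
  obtain ⟨V, hV⟩ := exists_linearMap_eqOn_nonneg v
    (fun x y hx hy => by
      have h := (hv' x hx).add (hv' y hy)
      rw [← Set.image_add, Icc_zero_add_Icc_zero hx hy] at h
      exact (hv' _ (add_nonneg hx hy)).unique h)
    (fun c x hc hx => by
      rcases hc.eq_or_lt with rfl | hc
      · have h := hv' (0 : E) le_rfl
        rw [Set.Icc_self, Set.image_singleton, map_zero] at h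
        simpa using h.unique isLUB_singleton
      refine (hv' _ (smul_nonneg hc.le hx)).unique ⟨?_, fun w hw => ?_⟩
      · rintro _ ⟨y, ⟨hy0, hy⟩, rfl⟩
        have h := (hv' x hx).1 ⟨c⁻¹ • y, ⟨smul_nonneg (inv_nonneg.mpr hc.le) hy0, ?_⟩, rfl⟩
        · have := smul_le_smul_of_nonneg_left h hc.le
          rwa [map_smul, smul_inv_smul₀ hc.ne'] at this
        · have := smul_le_smul_of_nonneg_left hy (inv_nonneg.mpr hc.le)
          rwa [inv_smul_smul₀ hc.ne'] at this
      · have h : v x ≤ c⁻¹ • w := by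
          refine (hv' x hx).2 ?_
          rintro _ ⟨y, ⟨hy0, hy⟩, rfl⟩
          have := hw ⟨c • y, ⟨smul_nonneg hc.le hy0, smul_le_smul_of_nonneg_left hy hc.le⟩, rfl⟩
          have := smul_le_smul_of_nonneg_left this (inv_nonneg.mpr hc.le)
          rwa [map_smul, inv_smul_smul₀ hc.ne'] at this
        have := smul_le_smul_of_nonneg_left h hc.le
        rwa [smul_inv_smul₀ hc.ne'] at this)
  exact ⟨V, fun x hx => hV x hx ▸ hv' x hx⟩

end RieszKantorovich

/-! ### Positive operators -/

section Positive

variable {E F : Type*} [NormedAddCommGroup E] [NormedSpace ℝ E] [Lattice E] [IsOrderedAddMonoid E]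
  [NormedAddCommGroup F] [NormedSpace ℝ F] [Lattice F] [IsOrderedAddMonoid F]

/-- If `±U ≤ V` in the operator order, then `|U x| ≤ V |x|`. -/
theorem abs_apply_le_of_opLE {U V : E →L[ℝ] F} (h₁ : OpLE U V) (h₂ : OpLE (-U) V) (x : E) :
    |U x| ≤ V |x| := by
  have hp := posPart_nonneg x
  have hn := negPart_nonneg x
  have hx : U x = U x⁺ - U x⁻ := by rw [← map_sub, posPart_sub_negPart]
  have hx' : V |x| = V x⁺ + V x⁻ := by rw [← map_add, posPart_add_negPart]
  have a₁ := h₁ _ hp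
  have a₂ := h₁ _ hn
  have b₁ := h₂ _ hp
  have b₂ := h₂ _ hn
  simp only [neg_apply] at b₁ b₂
  rw [abs_le', hx, hx']
  constructor
  · rw [sub_eq_add_neg]; exact add_le_add a₁ b₂
  · rw [neg_sub, sub_eq_neg_add]; exact add_le_add b₁ a₂

theorem opLE_zero_of_abs {U V : E →L[ℝ] F} (h₁ : OpLE U V)
    (h₂ : OpLE (-U) V) : OpLE 0 V := by
  intro x hx
  have := abs_apply_le_of_opLE h₁ h₂ x
  rw [abs_of_nonneg hx] at this
  exact (abs_nonneg _).trans this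

theorem abs_apply_le_of_nonneg_of_opLE {S T : E →L[ℝ] F} (hS : OpLE 0 S) (hST : OpLE S T) (x : E) :
    |S x| ≤ T |x| :=
  abs_apply_le_of_opLE hST
    (fun y hy => (neg_nonpos.mpr (hS y hy)).trans ((hS y hy).trans (hST y hy))) x

theorem norm_apply_le_of_opLE [HasSolidNorm E] [HasSolidNorm F] {U V : E →L[ℝ] F} (h₁ : OpLE U V)
    (h₂ : OpLE (-U) V) (x : E) : ‖U x‖ ≤ ‖V |x|‖ :=
  norm_le_norm_of_abs_le_abs ((abs_apply_le_of_opLE h₁ h₂ x).trans (le_abs_self _))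

theorem opNorm_le_of_opLE [HasSolidNorm E] [HasSolidNorm F] {U V : E →L[ℝ] F} (h₁ : OpLE U V)
    (h₂ : OpLE (-U) V) : ‖U‖ ≤ ‖V‖ :=
  U.opNorm_le_bound (norm_nonneg _) fun x => (norm_apply_le_of_opLE h₁ h₂ x).trans <| by
    simpa only [norm_abs_eq_norm] using V.le_opNorm |x|

theorem opLE_iff_of_isLUB_image_Icc {U V : E →L[ℝ] F}
    (hV : ∀ x, 0 ≤ x → IsLUB (U '' Set.Icc 0 x) (V x)) (W : E →L[ℝ] F) :
    OpLE V W ↔ OpLE 0 W ∧ OpLE U W := by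
  refine ⟨fun h => ⟨fun x hx => ((hV x hx).1 ⟨0, ⟨le_rfl, hx⟩, map_zero _⟩).trans (h x hx),
    fun x hx => ((hV x hx).1 ⟨x, ⟨hx, le_rfl⟩, rfl⟩).trans (h x hx)⟩, fun ⟨h₀, h⟩ x hx =>
    (hV x hx).2 ?_⟩
  rintro _ ⟨y, ⟨hy0, hy⟩, rfl⟩
  have : 0 ≤ W (x - y) := h₀ _ (sub_nonneg.mpr hy)
  rw [map_sub, sub_nonneg] at this
  exact (h y hy0).trans this

variable [IsOrderedModule ℝ E] [IsOrderedModule ℝ F] [HasSolidNorm E] [HasSolidNorm F]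

/-- The Riesz–Kantorovich positive part of a continuous operator is continuous as soon as the sets
`U [0, x]` have upper bounds of norm at most `C * ‖x‖`. -/
theorem exists_continuous_isLUB_image_Icc (hF : IsDedekindComplete F) (U : E →L[ℝ] F) (C : ℝ)
    (hb : ∀ x, 0 ≤ x → ∃ b ∈ upperBounds (U '' Set.Icc 0 x), ‖b‖ ≤ C * ‖x‖) :
    ∃ V : E →L[ℝ] F, ∀ x, 0 ≤ x → IsLUB (U '' Set.Icc 0 x) (V x) := by
  obtain ⟨V, hV⟩ := exists_isLUB_image_Icc hF (U : E →ₗ[ℝ] F) fun x hx =>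
    let ⟨b, hb, _⟩ := hb x hx
    ⟨b, hb⟩
  have hV0 : ∀ x, 0 ≤ x → 0 ≤ V x := fun x hx =>
    (hV x hx).1 ⟨0, ⟨le_rfl, hx⟩, map_zero _⟩
  have habs : ∀ x, |V x| ≤ V |x| := fun x => by
    rw [abs_le']
    constructor
    · simpa using hV0 _ (sub_nonneg.mpr (le_abs_self x))
    · have := hV0 (|x| + x) (by rw [← neg_le_iff_add_nonneg]; exact neg_le_abs x)
      rw [map_add] at this
      rwa [neg_le_iff_add_nonneg]
  refine ⟨V.mkContinuous C fun x => ?_, hV⟩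
  obtain ⟨b, hb, hbC⟩ := hb |x| (abs_nonneg x)
  rw [norm_abs_eq_norm] at hbC
  exact (norm_le_norm_of_abs_le_abs
    (((habs x).trans ((hV _ (abs_nonneg x)).2 hb)).trans (le_abs_self b))).trans hbC

/-- A continuous operator `U` below a positive one has a positive part among the continuous
operators, when the range is Dedekind complete. -/
theorem exists_posPart_of_opLE (hF : IsDedekindComplete F) {U R : E →L[ℝ] F} (hR : OpLE 0 R)
    (hUR : OpLE U R) : ∃ V : E →L[ℝ] F, ∀ W : E →L[ℝ] F, OpLE V W ↔ OpLE 0 W ∧ OpLE U W := by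
  have hb : ∀ x, R x ∈ upperBounds (U '' Set.Icc 0 x) := by
    rintro x _ ⟨y, ⟨hy0, hy⟩, rfl⟩
    have : 0 ≤ R (x - y) := hR _ (sub_nonneg.mpr hy)
    rw [map_sub, sub_nonneg] at this
    exact (hUR y hy0).trans this
  obtain ⟨V, hV⟩ := exists_continuous_isLUB_image_Icc hF U ‖R‖ fun x _ =>
    ⟨R x, hb x, R.le_opNorm x⟩
  exact ⟨V, opLE_iff_of_isLUB_image_Icc hV⟩

end Positive

/-! ### The enveloping norm -/

section Enveloping

variable {E F : Type*} [NormedAddCommGroup E] [NormedSpace ℝ E] [Lattice E]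
  [NormedAddCommGroup F] [NormedSpace ℝ F] [Lattice F] [IsOrderedAddMonoid F]
  [IsOrderedModule ℝ F] {P : Submodule ℝ (E →L[ℝ] F)}

theorem mem_of_mem_regularlyP {T : E →L[ℝ] F} (hT : T ∈ regularlyP P) : T ∈ P := by
  obtain ⟨A, hA, B, hB, -, -, rfl⟩ := hT
  exact P.sub_mem hA hB

theorem mem_regularlyP_of_nonneg {Q : E →L[ℝ] F} (hQ : Q ∈ P) (hQ0 : OpLE 0 Q) :
    Q ∈ regularlyP P :=
  ⟨Q, hQ, 0, P.zero_mem, hQ0, fun _ _ => le_rfl, (sub_zero Q).symm⟩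

theorem envelopingNorm_le {T : regularlyP P} {Q : E →L[ℝ] F} (hQ : Q ∈ P)
    (h₁ : OpLE (T : E →L[ℝ] F) Q) (h₂ : OpLE (-(T : E →L[ℝ] F)) Q) : envelopingNorm P T ≤ ‖Q‖ :=
  csInf_le ⟨0, by rintro _ ⟨S, -, -, -, rfl⟩; exact norm_nonneg S⟩ ⟨Q, hQ, h₁, h₂, rfl⟩

theorem envelopingNorm_nonneg (T : regularlyP P) : 0 ≤ envelopingNorm P T :=
  Real.sInf_nonneg (by rintro _ ⟨S, -, -, -, rfl⟩; exact norm_nonneg S)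

theorem exists_opLE_of_mem_regularlyP {T : E →L[ℝ] F} (hT : T ∈ regularlyP P) :
    ∃ Q ∈ P, OpLE T Q ∧ OpLE (-T) Q := by
  obtain ⟨A, hA, B, hB, hA0, hB0, rfl⟩ := hT
  refine ⟨A + B, P.add_mem hA hB, fun x hx => ?_, fun x hx => ?_⟩
  · have h : (0 : F) ≤ B x := hB0 x hx
    exact (sub_le_self _ h).trans (le_add_of_nonneg_right h)
  · have h : (0 : F) ≤ A x := hA0 x hx
    change -(A x - B x) ≤ A x + B x
    rw [neg_sub]
    exact (sub_le_self _ h).trans (le_add_of_nonneg_left h)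

theorem exists_norm_lt_of_envelopingNorm_lt {T : regularlyP P} {r : ℝ}
    (hr : envelopingNorm P T < r) :
    ∃ Q ∈ P, OpLE (T : E →L[ℝ] F) Q ∧ OpLE (-(T : E →L[ℝ] F)) Q ∧ ‖Q‖ < r := by
  obtain ⟨Q, hQ, h₁, h₂⟩ := exists_opLE_of_mem_regularlyP T.2
  obtain ⟨_, ⟨S, hS, h₁, h₂, rfl⟩, h⟩ := exists_lt_of_csInf_lt (s := {r : ℝ | ∃ S ∈ P,
    OpLE (T : E →L[ℝ] F) S ∧ OpLE (-(T : E →L[ℝ] F)) S ∧ r = ‖S‖}) ⟨‖Q‖, Q, hQ, h₁, h₂, rfl⟩ hr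
  exact ⟨S, hS, h₁, h₂, h⟩

theorem envelopingNorm_add_le (S T : regularlyP P) :
    envelopingNorm P (S + T) ≤ envelopingNorm P S + envelopingNorm P T := by
  refine le_of_forall_pos_le_add fun ε hε => ?_
  obtain ⟨Q, hQ, h₁, h₂, h⟩ := exists_norm_lt_of_envelopingNorm_lt
    (lt_add_of_pos_right (envelopingNorm P S) (half_pos hε))
  obtain ⟨Q', hQ', h₁', h₂', h'⟩ := exists_norm_lt_of_envelopingNorm_lt
    (lt_add_of_pos_right (envelopingNorm P T) (half_pos hε))
  have := envelopingNorm_le (T := S + T) (P.add_mem hQ hQ')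
    (fun x hx => add_le_add (h₁ x hx) (h₁' x hx))
    (fun x hx => by simpa [add_comm] using add_le_add (h₂ x hx) (h₂' x hx))
  have := norm_add_le Q Q'
  linarith

variable [IsOrderedAddMonoid E]

/-- If `±U ≤ Q`, then `U = (Q + U) - Q` is a difference of positive operators. -/
theorem mem_regularlyP_of_opLE {U Q : E →L[ℝ] F} (hU : U ∈ P) (hQ : Q ∈ P)
    (h₁ : OpLE U Q) (h₂ : OpLE (-U) Q) : U ∈ regularlyP P := by
  refine ⟨Q + U, P.add_mem hQ hU, Q, hQ, fun x hx => ?_, opLE_zero_of_abs h₁ h₂, by abel⟩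
  have := h₂ x hx
  simpa [neg_le_iff_add_nonneg, add_comm] using this

theorem norm_le_envelopingNorm [HasSolidNorm E] [HasSolidNorm F] (T : regularlyP P) :
    ‖(T : E →L[ℝ] F)‖ ≤ envelopingNorm P T := by
  refine le_of_forall_gt_imp_ge_of_dense fun r hr => ?_
  obtain ⟨Q, -, h₁, h₂, hQ⟩ := exists_norm_lt_of_envelopingNorm_lt hr
  exact (opNorm_le_of_opLE h₁ h₂).trans hQ.le

theorem envelopingNorm_smul_le (c : ℝ) (T : regularlyP P) :
    envelopingNorm P (c • T) ≤ |c| * envelopingNorm P T := by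
  rcases eq_or_ne c 0 with rfl | hc
  · have := envelopingNorm_le (T := (0 : ℝ) • T) P.zero_mem (fun x _ => by simp)
      (fun x _ => by simp)
    simpa using this
  rw [← div_le_iff₀' (abs_pos.mpr hc)]
  refine le_of_forall_gt_imp_ge_of_dense fun r hr => ?_
  obtain ⟨Q, hQ, h₁, h₂, h⟩ := exists_norm_lt_of_envelopingNorm_lt hr
  rw [div_le_iff₀' (abs_pos.mpr hc)]
  have key : ∀ x, 0 ≤ x → |c • (T : E →L[ℝ] F) x| ≤ |c| • Q x := fun x hx => by
    have h := abs_apply_le_of_opLE h₁ h₂ x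
    rw [abs_of_nonneg hx] at h
    exact (abs_smul_le _ _).trans (smul_le_smul_of_nonneg_left h (abs_nonneg c))
  have := envelopingNorm_le (T := c • T) (P.smul_mem |c| hQ)
    (fun x hx => (le_abs_self _).trans (key x hx)) (fun x hx => (neg_le_abs _).trans (key x hx))
  rw [norm_smul, Real.norm_eq_abs, abs_abs] at this
  exact this.trans (mul_le_mul_of_nonneg_left h.le (abs_nonneg c))

theorem envelopingNorm_smul (c : ℝ) (T : regularlyP P) :
    envelopingNorm P (c • T) = |c| * envelopingNorm P T := by
  refine (envelopingNorm_smul_le c T).antisymm ?_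
  rcases eq_or_ne c 0 with rfl | hc
  · simpa using envelopingNorm_nonneg (0 : regularlyP P)
  have h := envelopingNorm_smul_le c⁻¹ (c • T)
  rwa [inv_smul_smul₀ hc, abs_inv, ← div_eq_inv_mul, le_div_iff₀' (abs_pos.mpr hc)] at h

variable [HasSolidNorm E] [HasSolidNorm F]

/-- The limit step of completeness: a sequence whose consecutive differences are dominated by
positive operators `R k ∈ P` with `‖R k‖ ≤ 2⁻ᵏ` converges in the enveloping norm. -/
theorem exists_envelopingNorm_sub_le [CompleteSpace F] (hclosed : IsClosed (P : Set (E →L[ℝ] F)))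
    (u : ℕ → regularlyP P) (hu : ∀ k, envelopingNorm P (u (k + 1) - u k) < (1 / 2) ^ k) :
    ∃ T : regularlyP P, ∀ k, envelopingNorm P (T - u k) ≤ 2 * (1 / 2) ^ k := by
  choose R hRP hR₁ hR₂ hR using fun k => exists_norm_lt_of_envelopingNorm_lt (hu k)
  have hgeo : ∀ m : ℕ, HasSum (fun j : ℕ => ((1 : ℝ) / 2) ^ (m + j)) (2 * (1 / 2) ^ m) := by
    intro m
    have := hasSum_geometric_two.mul_left ((1 / 2 : ℝ) ^ m)
    simpa only [← pow_add, mul_comm _ (2 : ℝ)] using this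
  have hRs : ∀ m, Summable fun j => R (m + j) := fun m =>
    .of_norm_bounded (hgeo m).summable fun j => (hR _).le
  have hQ : ∀ m, (∑' j, R (m + j)) ∈ P := fun m =>
    hclosed.mem_of_tendsto (hRs m).hasSum.tendsto_sum_nat
      (Eventually.of_forall fun k => P.sum_mem fun j _ => hRP _)
  have hQn : ∀ m, ‖∑' j, R (m + j)‖ ≤ 2 * (1 / 2) ^ m := fun m =>
    tsum_of_norm_bounded (hgeo m) fun j => (hR _).le
  have hds : Summable fun j => ((u (j + 1) - u j : regularlyP P) : E →L[ℝ] F) :=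
    .of_norm_bounded summable_geometric_two
      fun j => (norm_le_envelopingNorm _).trans (hu j).le
  have htel : ∀ k m, (u (m + k) : E →L[ℝ] F) - u m =
      ∑ j ∈ Finset.range k, ((u (m + j + 1) - u (m + j) : regularlyP P) : E →L[ℝ] F) := by
    intro k m
    induction k with
    | zero => simp
    | succ k ih => rw [Finset.sum_range_succ, ← ih]; simp [add_assoc]
  obtain ⟨T, hT⟩ : ∃ T : E →L[ℝ] F, Tendsto (fun k => (u k : E →L[ℝ] F)) atTop (𝓝 T) := by
    refine ⟨_, (hds.hasSum.tendsto_sum_nat.add_const (u 0 : E →L[ℝ] F)).congr fun k => ?_⟩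
    have := htel k 0
    simp only [zero_add] at this
    rw [← this, sub_add_cancel]
  have hTP : T ∈ P := hclosed.mem_of_tendsto hT (Eventually.of_forall fun k =>
    mem_of_mem_regularlyP (u k).2)
  have habs : ∀ m x, 0 ≤ x → |(T - u m : E →L[ℝ] F) x| ≤ (∑' j, R (m + j)) x := by
    intro m x hx
    have ev : ∀ {S : ℕ → E →L[ℝ] F} {S' : E →L[ℝ] F}, Tendsto S atTop (𝓝 S') →
        Tendsto (fun k => S k x) atTop (𝓝 (S' x)) := fun h =>
      ((ContinuousLinearMap.apply ℝ F x).continuous.tendsto _).comp h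
    have h₁ := ev ((hT.comp (tendsto_add_atTop_nat m)).sub_const (u m : E →L[ℝ] F))
    have h₂ := ev (hRs m).hasSum.tendsto_sum_nat
    have hle : ∀ k, |((u (m + k) : E →L[ℝ] F) - (u m : E →L[ℝ] F)) x| ≤
        (∑ j ∈ Finset.range k, R (m + j)) x := by
      intro k
      have := abs_apply_le_of_opLE (U := (u (m + k) : E →L[ℝ] F) - (u m : E →L[ℝ] F))
        (V := ∑ j ∈ Finset.range k, R (m + j)) ?_ ?_ x
      · rwa [abs_of_nonneg hx] at this
      · intro y hy
        rw [htel, sum_apply, sum_apply]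
        exact Finset.sum_le_sum fun j _ => hR₁ _ y hy
      · intro y hy
        rw [htel, ← Finset.sum_neg_distrib, sum_apply,
          sum_apply]
        exact Finset.sum_le_sum fun j _ => hR₂ _ y hy
    have h₁' : ∀ k, ((u ∘ fun a => a + m) k) = u (m + k) := fun k => by simp [add_comm]
    rw [abs_le']
    refine ⟨le_of_tendsto_of_tendsto' h₁ h₂ fun k => ?_,
      le_of_tendsto_of_tendsto' h₁.neg h₂ fun k => ?_⟩
    · have := (le_abs_self _).trans (hle k)
      simpa [add_comm k m] using this
    · have := (neg_le_abs _).trans (hle k)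
      simpa [add_comm k m] using this
  have hle₁ : ∀ m, OpLE (T - u m : E →L[ℝ] F) (∑' j, R (m + j)) := fun m x hx =>
    (le_abs_self _).trans (habs m x hx)
  have hle₂ : ∀ m, OpLE (-(T - u m : E →L[ℝ] F)) (∑' j, R (m + j)) := fun m x hx =>
    (neg_le_abs _).trans (habs m x hx)
  have hTr : T ∈ regularlyP P := by
    have h := mem_regularlyP_of_opLE (P.sub_mem hTP (mem_of_mem_regularlyP (u 0).2)) (hQ 0)
      (hle₁ 0) (hle₂ 0)
    simpa using (regularlyP P).add_mem h (u 0).2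
  exact ⟨⟨T, hTr⟩, fun k => (envelopingNorm_le (hQ k) (hle₁ k) (hle₂ k)).trans (hQn k)⟩

/-- If `P` is a norm closed space of operators that contains every positive operator dominated by
one of its members, then `r-P(E, F)` is a Banach lattice for the enveloping norm. -/
theorem isBanachLatticeNorm_envelopingNorm [IsOrderedModule ℝ E] [CompleteSpace F]
    (hF : IsDedekindComplete F) (hclosed : IsClosed (P : Set (E →L[ℝ] F)))
    (hdom : ∀ S T : E →L[ℝ] F, OpLE 0 S → OpLE S T → T ∈ P → S ∈ P) :
    IsBanachLatticeNorm (regularlyP P) (envelopingNorm P) := by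
  have hsup : ∀ S T : regularlyP P, ∃ U, IsLUB {S, T} U := by
    intro S T
    -- `S ∨ T = S + (T - S)⁺`
    obtain ⟨A, hA, B, hB, hA0, hB0, hAB⟩ := (T - S).2
    have hle : OpLE ((T - S : regularlyP P) : E →L[ℝ] F) A := fun x hx => by
      rw [hAB]
      exact sub_le_self _ (hB0 x hx)
    obtain ⟨V, hV⟩ := exists_posPart_of_opLE hF hA0 hle
    obtain ⟨hV0, hUV⟩ := (hV V).mp fun _ _ => le_rfl
    have hVP : V ∈ P := hdom V A hV0 ((hV A).mpr ⟨hA0, hle⟩) hA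
    refine ⟨S + ⟨V, mem_regularlyP_of_nonneg hVP hV0⟩, ?_, fun W hW => ?_⟩
    · rintro W (rfl | rfl)
      · intro x hx
        exact le_add_of_nonneg_right (hV0 x hx)
      · intro x hx
        have : (W : E →L[ℝ] F) x - (S : E →L[ℝ] F) x ≤ V x := hUV x hx
        exact sub_le_iff_le_add'.mp this
    · have hSW : OpLE (S : E →L[ℝ] F) W := hW (Set.mem_insert _ _)
      have hTW : OpLE (T : E →L[ℝ] F) W := hW (Set.mem_insert_of_mem _ rfl)
      intro x hx
      exact le_sub_iff_add_le'.mp ((hV (W - S : E →L[ℝ] F)).mpr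
        ⟨fun y hy => sub_nonneg.mpr (hSW y hy), fun y hy => sub_le_sub_right (hTW y hy) _⟩ x hx)
  refine
    { add_le_add := fun S T U h x hx => add_le_add_left (h x hx) _
      smul_nonneg := fun c T hc hT x hx => smul_nonneg hc (hT x hx)
      exists_sup := hsup
      exists_inf := fun S T => ?_
      nonneg := envelopingNorm_nonneg
      eq_zero_iff := fun T => ⟨fun h => ?_, ?_⟩
      norm_add_le := envelopingNorm_add_le
      norm_smul := envelopingNorm_smul
      solid := fun S T absS absT hS hT h => ?_
      complete := fun u hu => ?_ }
  · have hneg : ∀ {A B : regularlyP P}, -A ≤ B → -B ≤ A := fun {A B} h x hx =>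
      neg_le.mp (h x hx)
    obtain ⟨U, hU⟩ := hsup (-S) (-T)
    refine ⟨-U, ?_, fun W hW => ?_⟩
    · rintro W (rfl | rfl)
      · exact hneg (hU.1 (Set.mem_insert _ _))
      · exact hneg (hU.1 (Set.mem_insert_of_mem _ rfl))
    · intro x hx
      refine le_neg.mp (hU.2 (?_ : -W ∈ upperBounds {-S, -T}) x hx)
      rintro _ (rfl | rfl)
      · intro y hy
        exact neg_le_neg (hW (Set.mem_insert _ _) y hy)
      · intro y hy
        exact neg_le_neg (hW (Set.mem_insert_of_mem _ rfl) y hy)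
  · have := norm_le_envelopingNorm T
    rw [h, norm_le_zero_iff] at this
    exact Subtype.ext this
  · rintro rfl
    simpa using envelopingNorm_smul (0 : ℝ) (0 : regularlyP P)
  · -- every `Q ∈ P` dominating `±T` dominates `|T|`, hence `|S|`, hence `±S`
    refine le_of_forall_gt_imp_ge_of_dense fun r hr => ?_
    obtain ⟨Q, hQ, h₁, h₂, hQr⟩ := exists_norm_lt_of_envelopingNorm_lt hr
    have hTQ : absT ≤ ⟨Q, mem_regularlyP_of_nonneg hQ (opLE_zero_of_abs h₁ h₂)⟩ := by
      refine hT.2 ?_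
      rintro _ (rfl | rfl)
      exacts [h₁, h₂]
    refine (envelopingNorm_le hQ ?_ ?_).trans hQr.le
    · exact (hS.1 (Set.mem_insert _ _)).trans (h.trans hTQ)
    · exact (hS.1 (Set.mem_insert_of_mem _ rfl)).trans (h.trans hTQ)
  · choose n hn using fun k : ℕ => hu ((1 / 2) ^ k) (by positivity)
    -- the indices `φ k` increase with `k` and lie beyond `n k`
    let φ : ℕ → ℕ := fun k => ∑ i ∈ Finset.range (k + 1), n i
    have hφ : ∀ k, n k ≤ φ k := fun k =>
      Finset.single_le_sum (f := n) (fun _ _ => Nat.zero_le _) (Finset.self_mem_range_succ k)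
    have hφ' : ∀ k, φ k ≤ φ (k + 1) := fun k => by
      simp only [φ]; rw [Finset.sum_range_succ _ (k + 1)]; exact Nat.le_add_right _ _
    obtain ⟨T, hT⟩ := exists_envelopingNorm_sub_le hclosed (fun k => u (φ k)) fun k =>
      hn k _ ((hφ k).trans (hφ' k)) _ (hφ k)
    refine ⟨T, ?_⟩
    have hbd : ∀ k, ∀ m ≥ φ k, envelopingNorm P (u m - T) ≤ 3 * (1 / 2) ^ k := by
      intro k m hm
      have h₁ := envelopingNorm_add_le (u m - u (φ k)) (u (φ k) - T)
      have h₂ := hn k m ((hφ k).trans hm) _ (hφ k)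
      have h₃ : envelopingNorm P (u (φ k) - T) = envelopingNorm P (T - u (φ k)) := by
        rw [show u (φ k) - T = (-1 : ℝ) • (T - u (φ k)) by module, envelopingNorm_smul, abs_neg,
          abs_one, one_mul]
      have h₄ := hT k
      rw [sub_add_sub_cancel] at h₁
      linarith
    rw [Metric.tendsto_atTop]
    intro ε hε
    obtain ⟨k, hk⟩ := exists_pow_lt_of_lt_one (show 0 < ε / 3 by positivity)
      (show (1 / 2 : ℝ) < 1 by norm_num)
    refine ⟨φ k, fun m hm => ?_⟩
    rw [Real.dist_0_eq_abs, abs_of_nonneg (envelopingNorm_nonneg _)]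
    linarith [hbd k m hm]

end Enveloping

/-! ### The dual of a normed lattice -/

section Dual

theorem isDedekindComplete_real : IsDedekindComplete ℝ := fun _ hs hb =>
  ⟨_, isLUB_csSup hs hb⟩

variable {X : Type*} [NormedAddCommGroup X] [NormedSpace ℝ X] [Lattice X] [IsOrderedAddMonoid X]
  [IsOrderedModule ℝ X] [HasSolidNorm X]

theorem exists_isLUB_dual_image_Icc (f : StrongDual ℝ X) :
    ∃ g : StrongDual ℝ X, ∀ x, 0 ≤ x → IsLUB (f '' Set.Icc 0 x) (g x) := by
  refine exists_continuous_isLUB_image_Icc isDedekindComplete_real f ‖f‖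
    fun x hx => ⟨‖f‖ * ‖x‖, ?_, by simp⟩
  rintro _ ⟨y, ⟨hy0, hy⟩, rfl⟩
  have : ‖y‖ ≤ ‖x‖ :=
    norm_le_norm_of_abs_le_abs (by rwa [abs_of_nonneg hy0, abs_of_nonneg hx])
  exact (Real.le_norm_self _).trans
    ((f.le_opNorm y).trans (mul_le_mul_of_nonneg_left this (norm_nonneg f)))

/-- The positive part of a continuous functional, given by the Riesz–Kantorovich formula. -/
noncomputable def dualPosPart (f : StrongDual ℝ X) : StrongDual ℝ X :=
  (exists_isLUB_dual_image_Icc f).choose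

theorem isLUB_dualPosPart (f : StrongDual ℝ X) {x : X} (hx : 0 ≤ x) :
    IsLUB (f '' Set.Icc 0 x) (dualPosPart f x) :=
  (exists_isLUB_dual_image_Icc f).choose_spec x hx

theorem dualPosPart_opLE_iff {f g : StrongDual ℝ X} :
    OpLE (dualPosPart f) g ↔ OpLE 0 g ∧ OpLE f g :=
  opLE_iff_of_isLUB_image_Icc (fun _ hx => isLUB_dualPosPart f hx) g

/-- The dual of a normed lattice carries the operator order. -/
instance StrongDual.instPartialOrder : PartialOrder (StrongDual ℝ X) where
  le f g := OpLE f g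
  le_refl _ _ _ := le_rfl
  le_trans _ _ _ h₁ h₂ x hx := (h₁ x hx).trans (h₂ x hx)
  le_antisymm f g h₁ h₂ := by
    ext x
    have h : ∀ y : X, 0 ≤ y → f y = g y := fun y hy => le_antisymm (h₁ y hy) (h₂ y hy)
    rw [← posPart_sub_negPart x, map_sub, map_sub, h _ (posPart_nonneg x),
      h _ (negPart_nonneg x)]

instance StrongDual.instIsOrderedAddMonoid : IsOrderedAddMonoid (StrongDual ℝ X) where
  add_le_add_left _ _ h k x hx := add_le_add_left (h x hx) (k x)

instance StrongDual.instIsOrderedModule : IsOrderedModule ℝ (StrongDual ℝ X) where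
  smul_le_smul_of_nonneg_left _ hc _ _ h x hx := mul_le_mul_of_nonneg_left (h x hx) hc
  smul_le_smul_of_nonneg_right _ hf _ _ h x hx := mul_le_mul_of_nonneg_right h (hf x hx)

/-- The dual of a normed lattice is a lattice, with `f ⊔ g = f + (g - f)⁺`. -/
noncomputable instance StrongDual.instLattice : Lattice (StrongDual ℝ X) :=
  have hsup : ∀ f g h : StrongDual ℝ X, f + dualPosPart (g - f) ≤ h ↔ f ≤ h ∧ g ≤ h := by
    intro f g h
    rw [← le_sub_iff_add_le']
    refine dualPosPart_opLE_iff.trans ?_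
    change 0 ≤ h - f ∧ g - f ≤ h - f ↔ _
    rw [sub_nonneg, sub_le_sub_iff_right]
  { StrongDual.instPartialOrder with
    sup := fun f g => f + dualPosPart (g - f)
    le_sup_left := fun f g => ((hsup f g _).mp le_rfl).1
    le_sup_right := fun f g => ((hsup f g _).mp le_rfl).2
    sup_le := fun f g h h₁ h₂ => (hsup f g h).mpr ⟨h₁, h₂⟩
    inf := fun f g => -(-f + dualPosPart (-g - -f))
    inf_le_left := fun f g => neg_le.mp ((hsup (-f) (-g) _).mp le_rfl).1
    inf_le_right := fun f g => neg_le.mp ((hsup (-f) (-g) _).mp le_rfl).2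
    le_inf := fun f g h h₁ h₂ =>
      le_neg.mp ((hsup (-g) (-h) (-f)).mpr ⟨neg_le_neg h₁, neg_le_neg h₂⟩) }

theorem StrongDual.abs_apply_le (f : StrongDual ℝ X) (x : X) : |f x| ≤ |f| |x| :=
  abs_apply_le_of_opLE (le_abs_self f) (neg_le_abs f) x

theorem StrongDual.abs_apply_le_norm (f : StrongDual ℝ X) {x : X} (hx : 0 ≤ x) :
    |f| x ≤ ‖f‖ * ‖x‖ := by
  change f x + dualPosPart (-f - f) x ≤ _
  rw [← le_sub_iff_add_le']
  refine (isLUB_dualPosPart _ hx).2 ?_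
  rintro _ ⟨z, ⟨hz0, hz⟩, rfl⟩
  have hxz : |x - (z + z)| ≤ |x| := by
    rw [abs_of_nonneg hx, abs_le', neg_sub]
    exact ⟨sub_le_self _ (add_nonneg hz0 hz0), sub_le_iff_le_add.mpr (add_le_add hz hz)⟩
  have := (Real.le_norm_self _).trans ((f.le_opNorm (x - (z + z))).trans
    (mul_le_mul_of_nonneg_left (norm_le_norm_of_abs_le_abs hxz) (norm_nonneg f)))
  rw [map_sub, map_add] at this
  simp only [sub_apply, neg_apply]
  linarith

instance StrongDual.instHasSolidNorm : HasSolidNorm (StrongDual ℝ X) where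
  solid f g h := f.opNorm_le_bound (norm_nonneg _) fun x => by
    refine (StrongDual.abs_apply_le f x).trans ((h _ (abs_nonneg x)).trans ?_)
    simpa only [norm_abs_eq_norm] using StrongDual.abs_apply_le_norm g (abs_nonneg x)

end Dual

/-! ### Weakly null sequences -/

section WeaklyNull

variable {X : Type*} [NormedAddCommGroup X] [NormedSpace ℝ X]

theorem IsWeaklyNull.exists_norm_le {x : ℕ → X} (hx : IsWeaklyNull x) : ∃ C, ∀ n, ‖x n‖ ≤ C := by
  obtain ⟨C, hC⟩ := banach_steinhaus (g := fun n => NormedSpace.inclusionInDoubleDual ℝ X (x n))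
    fun f => by
      obtain ⟨C, hC⟩ := (hx f).norm.bddAbove_range
      exact ⟨C, fun n => hC ⟨n, rfl⟩⟩
  exact ⟨C, fun n => ((NormedSpace.inclusionInDoubleDualLi ℝ).norm_map (x n)).symm.trans_le (hC n)⟩

theorem IsWeaklyNull.comp {x : ℕ → X} (hx : IsWeaklyNull x) {φ : ℕ → ℕ} (hφ : StrictMono φ) :
    IsWeaklyNull (x ∘ φ) := fun f => (hx f).comp hφ.tendsto_atTop

theorem IsWeaklyNull.map {Y : Type*} [NormedAddCommGroup Y] [NormedSpace ℝ Y] {x : ℕ → X}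
    (hx : IsWeaklyNull x) (T : X →L[ℝ] Y) : IsWeaklyNull fun n => T (x n) :=
  fun f => hx (f.comp T)

theorem abs_tsum_le_tsum_abs {ι : Type*} {a : ι → ℝ} (ha : Summable fun i => |a i|) :
    |∑' i, a i| ≤ ∑' i, |a i| := by
  simp only [← Real.norm_eq_abs] at ha ⊢
  exact norm_tsum_le_tsum_norm ha

theorem exists_dual_eq_tsum {ψ : ℕ → StrongDual ℝ X} {C : ℝ}
    (hψ : ∀ x (s : Finset ℕ), ∑ n ∈ s, |ψ n x| ≤ C * ‖x‖) :
    ∃ Ψ : StrongDual ℝ X, ∀ x, Ψ x = ∑' n, ψ n x := by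
  have habs : ∀ x, Summable fun n => |ψ n x| := fun x =>
    summable_of_sum_le (fun _ => abs_nonneg _) (hψ x)
  have hsum : ∀ x, Summable fun n => ψ n x := fun x => (habs x).of_abs
  let Ψ : X →ₗ[ℝ] ℝ :=
    { toFun := fun x => ∑' n, ψ n x
      map_add' := fun x y => by
        simp only [map_add]
        exact (hsum x).tsum_add (hsum y)
      map_smul' := fun c x => by
        simp only [map_smul, RingHom.id_apply]
        exact tsum_const_smul'' c }
  refine ⟨Ψ.mkContinuous C fun x => ?_, fun x => rfl⟩
  exact (abs_tsum_le_tsum_abs (habs x)).trans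
    (Real.tsum_le_of_sum_le (fun _ => abs_nonneg _) (hψ x))

/-- A sliding hump argument, which is the Schur property of `ℓ¹` for the map `x ↦ (ψₙ x)ₙ` from
`X` to `ℓ¹`. -/
theorem IsWeaklyNull.tendsto_apply_of_sum_abs_le {f : ℕ → X} (hf : IsWeaklyNull f)
    {ψ : ℕ → StrongDual ℝ X} {C : ℝ} (hψ : ∀ x (s : Finset ℕ), ∑ n ∈ s, |ψ n x| ≤ C * ‖x‖) :
    Tendsto (fun n => ψ n (f n)) atTop (𝓝 0) := by
  have hsum : ∀ x, Summable fun n => |ψ n x| := fun x =>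
    summable_of_sum_le (fun _ => abs_nonneg _) (hψ x)
  by_contra hcon
  rw [Metric.tendsto_atTop] at hcon
  push Not at hcon
  obtain ⟨ε, hε, hcon⟩ := hcon
  have hfreq : ∃ᶠ n in atTop, ε ≤ |ψ n (f n)| := by
    rw [frequently_atTop]
    simpa only [Real.dist_0_eq_abs, ge_iff_le, exists_prop] using hcon
  -- a subsequence along which both the earlier and the later functionals are small at `f n`
  obtain ⟨φ, hφ, hφ'⟩ := exists_seq_of_forall_finset_exists (fun n => ε ≤ |ψ n (f n)|)
    (fun m n => m < n ∧ |ψ m (f n)| ≤ ε / 8 * (1 / 2) ^ m ∧ ∑' j, |ψ (j + n) (f m)| ≤ ε / 4)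
    fun s _ => by
      have hev : ∀ m ∈ s, ∀ᶠ n in atTop, m < n ∧ |ψ m (f n)| ≤ ε / 8 * (1 / 2) ^ m ∧
          ∑' j, |ψ (j + n) (f m)| ≤ ε / 4 := fun m _ => by
        have h₁ : Tendsto (fun n => |ψ m (f n)|) atTop (𝓝 0) := by simpa using (hf (ψ m)).abs
        exact (eventually_gt_atTop m).and ((h₁.eventually_le_const (by positivity)).and
          ((tendsto_sum_nat_add fun j => |ψ j (f m)|).eventually_le_const (by positivity)))
      exact (hfreq.and_eventually ((eventually_all_finset s).mpr hev)).exists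
  have hmono : StrictMono φ := fun m n h => (hφ' m n h).1
  have hsub : ∀ x, Summable fun n => |ψ (φ n) x| := fun x =>
    (hsum x).comp_injective hmono.injective
  obtain ⟨Ψ, hΨ_eq⟩ := exists_dual_eq_tsum (ψ := fun n => ψ (φ n)) (C := C) fun x s => by
    simpa using hψ x (s.map ⟨φ, hmono.injective⟩)
  have hΨ : ∀ k, ε / 2 ≤ |Ψ (f (φ k))| := by
    intro k
    have h₁ : |∑ i ∈ Finset.range k, ψ (φ i) (f (φ k))| ≤ ε / 4 := by
      refine (Finset.abs_sum_le_sum_abs _ _).trans ?_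
      calc ∑ i ∈ Finset.range k, |ψ (φ i) (f (φ k))|
          ≤ ∑ i ∈ Finset.range k, ε / 8 * (1 / 2) ^ i :=
            Finset.sum_le_sum fun i hi => (hφ' i k (Finset.mem_range.mp hi)).2.1.trans
              (mul_le_mul_of_nonneg_left
                (pow_le_pow_of_le_one (by norm_num) (by norm_num) hmono.le_apply) (by positivity))
        _ ≤ ε / 8 * 2 := by
            rw [← Finset.mul_sum]
            exact mul_le_mul_of_nonneg_left (sum_geometric_two_le k) (by positivity)
        _ = ε / 4 := by ring
    have h₂ : |∑' i, ψ (φ (i + (k + 1))) (f (φ k))| ≤ ε / 4 := by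
      have hs := (summable_nat_add_iff (k + 1)).mpr (hsub (f (φ k)))
      refine (abs_tsum_le_tsum_abs hs).trans (le_trans ?_ (hφ' k (k + 1) k.lt_succ_self).2.2)
      have hle : ∀ i, φ (k + 1) ≤ φ (i + (k + 1)) := fun i => hmono.monotone (by omega)
      have hinj : Function.Injective fun i => φ (i + (k + 1)) - φ (k + 1) := fun i j h => by
        have := hle i
        have := hle j
        have : φ (i + (k + 1)) = φ (j + (k + 1)) := by simp only at h; omega
        have := hmono.injective this
        omega
      have := tsum_comp_le_tsum_of_inj
        ((summable_nat_add_iff (φ (k + 1))).mpr (hsum (f (φ k)))) (fun _ => abs_nonneg _) hinj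
      simpa only [Function.comp_def, Nat.sub_add_cancel (hle _), Real.norm_eq_abs] using this
    have h₃ : Ψ (f (φ k)) = ∑ i ∈ Finset.range k, ψ (φ i) (f (φ k)) + ψ (φ k) (f (φ k)) +
        ∑' i, ψ (φ (i + (k + 1))) (f (φ k)) := by
      rw [← Finset.sum_range_succ, hΨ_eq]
      exact ((hsub _).of_abs.sum_add_tsum_nat_add (k + 1)).symm
    have h₄ := hφ k
    rw [h₃]
    rw [abs_le] at h₁ h₂
    rcases le_abs.mp h₄ with h | h
    · exact le_abs.mpr (Or.inl (by linarith))
    · exact le_abs.mpr (Or.inr (by linarith))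
  have hlim := ((hf.comp hmono) Ψ).abs
  rw [abs_zero] at hlim
  have := ge_of_tendsto' hlim hΨ
  linarith

end WeaklyNull

/-! ### Disjoint sequences dominated by weakly null sequences -/

section Disjoint

theorem inf_add_le_inf_add_inf {G : Type*} [AddCommGroup G] [Lattice G] [IsOrderedAddMonoid G]
    {a b c : G} (ha : 0 ≤ a) (hb : 0 ≤ b) (hc : 0 ≤ c) : c ⊓ (a + b) ≤ c ⊓ a + c ⊓ b := by
  rw [add_inf, inf_add, inf_add]
  refine le_inf (le_inf ?_ ?_) (le_inf ?_ inf_le_right)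
  · exact inf_le_left.trans (le_add_of_nonneg_left hc)
  · exact inf_le_left.trans (le_add_of_nonneg_left ha)
  · exact inf_le_left.trans (le_add_of_nonneg_right hb)

theorem sum_le_of_pairwise_inf_eq_zero {G ι : Type*} [AddCommGroup G] [Lattice G]
    [IsOrderedAddMonoid G] {b : ι → G} {z : G} (hz : 0 ≤ z) (h0 : ∀ i, 0 ≤ b i)
    (hb : ∀ i, b i ≤ z) (hd : ∀ i j, i ≠ j → b i ⊓ b j = 0) (s : Finset ι) :
    ∑ i ∈ s, b i ≤ z := by
  classical
  have hinf : ∀ (i : ι) (s : Finset ι), i ∉ s → b i ⊓ ∑ j ∈ s, b j ≤ 0 := by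
    intro i s
    induction s using Finset.induction_on with
    | empty => intro _; simp
    | insert j s hj ih =>
      intro hi
      rw [Finset.mem_insert, not_or] at hi
      rw [Finset.sum_insert hj]
      refine (inf_add_le_inf_add_inf (h0 j) (Finset.sum_nonneg fun i _ => h0 i) (h0 i)).trans ?_
      rw [hd i j hi.1, zero_add]
      exact ih hi.2
  induction s using Finset.induction_on with
  | empty => simpa using hz
  | insert i s hi ih =>
    rw [Finset.sum_insert hi, ← inf_add_sup]
    exact (add_le_of_nonpos_left (hinf i s hi)).trans (sup_le (hb i) ih)

theorem smul_inf_of_pos {X : Type*} [AddCommGroup X] [Module ℝ X] [Lattice X]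
    [IsOrderedModule ℝ X] {c : ℝ} (hc : 0 < c) (x y : X) : c • (x ⊓ y) = c • x ⊓ c • y := by
  refine le_antisymm (le_inf (smul_le_smul_of_nonneg_left inf_le_left hc.le)
    (smul_le_smul_of_nonneg_left inf_le_right hc.le)) ?_
  rw [← inv_smul_le_iff_of_pos hc]
  refine le_inf ?_ ?_
  · simpa [smul_smul, inv_mul_cancel₀ hc.ne'] using smul_le_smul_of_nonneg_left
      (inf_le_left : c • x ⊓ c • y ≤ c • x) (inv_nonneg.mpr hc.le)
  · simpa [smul_smul, inv_mul_cancel₀ hc.ne'] using smul_le_smul_of_nonneg_left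
      (inf_le_right : c • x ⊓ c • y ≤ c • y) (inv_nonneg.mpr hc.le)

theorem inf_smul_smul_eq_zero {X : Type*} [AddCommGroup X] [Module ℝ X] [Lattice X]
    [IsOrderedAddMonoid X] [IsOrderedModule ℝ X] {x y : X}
    (h : x ⊓ y = 0) (m : ℕ) : ((m : ℝ) • x) ⊓ ((m : ℝ) • y) = 0 := by
  rcases m.eq_zero_or_pos with rfl | hm
  · simp
  · rw [← smul_inf_of_pos (by exact_mod_cast hm), h, smul_zero]

variable {X : Type*} [NormedAddCommGroup X] [NormedSpace ℝ X] [Lattice X] [IsOrderedAddMonoid X]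

theorem StrongDual.apply_mono {φ : StrongDual ℝ X} (hφ : 0 ≤ φ) {x y : X} (h : x ≤ y) :
    φ x ≤ φ y := by
  have : 0 ≤ φ (y - x) := hφ _ (sub_nonneg.mpr h)
  rwa [map_sub, sub_nonneg] at this

/-- For a positive functional `φ` and `0 ≤ g`, the seminorm `x ↦ sup_m φ (|x| ∧ m g)`: the value at
`|x|` of the component of `φ` carried by the principal ideal of `g`. -/
noncomputable def carriedSeminorm (φ : StrongDual ℝ X) (g x : X) : ℝ :=
  ⨆ m : ℕ, φ (|x| ⊓ (m : ℝ) • g)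

variable {φ : StrongDual ℝ X} {g : X}

theorem bddAbove_range_apply_inf_smul (hφ : 0 ≤ φ) (x : X) :
    BddAbove (Set.range fun m : ℕ => φ (|x| ⊓ (m : ℝ) • g)) :=
  ⟨φ |x|, by rintro _ ⟨m, rfl⟩; exact StrongDual.apply_mono hφ inf_le_left⟩

theorem apply_inf_smul_le_carriedSeminorm (hφ : 0 ≤ φ) (x : X) (m : ℕ) :
    φ (|x| ⊓ (m : ℝ) • g) ≤ carriedSeminorm φ g x :=
  le_ciSup (bddAbove_range_apply_inf_smul hφ x) m

theorem carriedSeminorm_nonneg (hφ : 0 ≤ φ) (x : X) : 0 ≤ carriedSeminorm φ g x :=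
  le_trans (by simp) (apply_inf_smul_le_carriedSeminorm hφ x 0)

variable [IsOrderedModule ℝ X]

theorem carriedSeminorm_add_le (hφ : 0 ≤ φ) (hg : 0 ≤ g) (x y : X) :
    carriedSeminorm φ g (x + y) ≤ carriedSeminorm φ g x + carriedSeminorm φ g y := by
  refine ciSup_le fun m => ?_
  refine le_trans ?_ (add_le_add (apply_inf_smul_le_carriedSeminorm hφ x m)
    (apply_inf_smul_le_carriedSeminorm hφ y m))
  rw [← map_add]
  refine StrongDual.apply_mono hφ ?_
  rw [inf_comm, inf_comm |x|, inf_comm |y|]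
  exact (inf_le_inf_left _ (abs_add_le x y)).trans (inf_add_le_inf_add_inf (abs_nonneg x)
    (abs_nonneg y) (smul_nonneg (Nat.cast_nonneg m) hg))

theorem carriedSeminorm_smul_le (hφ : 0 ≤ φ) (hg : 0 ≤ g) (c : ℝ) (x : X) :
    carriedSeminorm φ g (c • x) ≤ |c| * carriedSeminorm φ g x := by
  refine ciSup_le fun m => ?_
  rcases eq_or_ne c 0 with rfl | hc
  · simp [inf_of_le_left (smul_nonneg (Nat.cast_nonneg (α := ℝ) m) hg)]
  have hc' : 0 < |c| := abs_pos.mpr hc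
  -- `|c x| ∧ m g ≤ |c| (|x| ∧ k g)` as soon as `m ≤ |c| k`
  obtain ⟨k, hk⟩ := exists_nat_ge (|c|⁻¹ * m)
  refine le_trans ?_ (mul_le_mul_of_nonneg_left (apply_inf_smul_le_carriedSeminorm hφ x k) hc'.le)
  rw [← smul_eq_mul, ← map_smul, smul_inf_of_pos hc']
  refine StrongDual.apply_mono hφ (inf_le_inf (abs_smul_le c x) ?_)
  rw [smul_smul]
  exact smul_le_smul_of_nonneg_right ((inv_mul_le_iff₀ hc').mp hk) hg

theorem carriedSeminorm_smul (hφ : 0 ≤ φ) (hg : 0 ≤ g) (c : ℝ) (x : X) :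
    carriedSeminorm φ g (c • x) = |c| * carriedSeminorm φ g x := by
  refine (carriedSeminorm_smul_le hφ hg c x).antisymm ?_
  rcases eq_or_ne c 0 with rfl | hc
  · rw [abs_zero, zero_mul]
    exact carriedSeminorm_nonneg hφ _
  · have h := carriedSeminorm_smul_le hφ hg c⁻¹ (c • x)
    rwa [inv_smul_smul₀ hc, abs_inv, ← div_eq_inv_mul, le_div_iff₀' (abs_pos.mpr hc)] at h

/-- The seminorms carried by disjoint elements add up to at most `φ |x|`. -/
theorem sum_carriedSeminorm_le (hφ : 0 ≤ φ) {g : ℕ → X} (hg : ∀ n, 0 ≤ g n)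
    (hd : IsDisjointSeq g) (x : X) (s : Finset ℕ) :
    ∑ n ∈ s, carriedSeminorm φ (g n) x ≤ φ |x| := by
  have hlim : Tendsto (fun m : ℕ => ∑ n ∈ s, φ (|x| ⊓ (m : ℝ) • g n)) atTop
      (𝓝 (∑ n ∈ s, carriedSeminorm φ (g n) x)) :=
    tendsto_finsetSum s fun n _ => tendsto_atTop_ciSup
      (fun k m hkm => StrongDual.apply_mono hφ (inf_le_inf_left _
        (smul_le_smul_of_nonneg_right (Nat.cast_le.mpr hkm) (hg n))))
      (bddAbove_range_apply_inf_smul hφ x)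
  refine le_of_tendsto' hlim fun m => ?_
  rw [← map_sum]
  have hmg : ∀ i, 0 ≤ (m : ℝ) • g i := fun i => smul_nonneg (Nat.cast_nonneg m) (hg i)
  refine StrongDual.apply_mono hφ (sum_le_of_pairwise_inf_eq_zero (abs_nonneg x)
    (fun i => le_inf (abs_nonneg x) (hmg i)) (fun i => inf_le_left) (fun i j hij => ?_) s)
  have h := hd i j hij
  rw [abs_of_nonneg (hg i), abs_of_nonneg (hg j)] at h
  refine le_antisymm ?_ (le_inf (le_inf (abs_nonneg x) (hmg i)) (le_inf (abs_nonneg x) (hmg j)))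
  exact (inf_le_inf inf_le_right inf_le_right).trans
    (inf_smul_smul_eq_zero h m).le

variable [HasSolidNorm X]

/-- Hahn–Banach for the carried seminorm: some functional below it is at least `φ g` at any `f`
with `g ≤ |f|`. -/
theorem exists_dual_le_carriedSeminorm (hφ : 0 ≤ φ) (hg : 0 ≤ g) {f : X} (hgf : g ≤ |f|) :
    ∃ ψ : StrongDual ℝ X, φ g ≤ ψ f ∧ ∀ x, |ψ x| ≤ carriedSeminorm φ g x := by
  rcases eq_or_ne f 0 with rfl | hf
  · have : g = 0 := le_antisymm (by simpa using hgf) hg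
    exact ⟨0, by simp [this], fun x => by simpa using carriedSeminorm_nonneg hφ x⟩
  have hgp : φ g ≤ carriedSeminorm φ g f := by
    have := apply_inf_smul_le_carriedSeminorm (g := g) hφ f 1
    rwa [Nat.cast_one, one_smul, inf_of_le_right hgf] at this
  obtain ⟨ψ, hψ, hψ'⟩ := exists_extension_of_le_sublinear
    (LinearPMap.mkSpanSingleton f (carriedSeminorm φ g f) hf) (carriedSeminorm φ g)
    (fun c hc x => by rw [carriedSeminorm_smul hφ hg, abs_of_pos hc])
    (carriedSeminorm_add_le hφ hg)
    (by
      rintro ⟨x, hx⟩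
      obtain ⟨t, rfl⟩ := Submodule.mem_span_singleton.mp hx
      rw [LinearPMap.mkSpanSingleton'_apply, smul_eq_mul, carriedSeminorm_smul hφ hg]
      exact mul_le_mul_of_nonneg_right (le_abs_self t) (carriedSeminorm_nonneg hφ f))
  have habs : ∀ x, |ψ x| ≤ carriedSeminorm φ g x := fun x => by
    refine abs_le'.mpr ⟨hψ' x, ?_⟩
    have h := (hψ' (-x)).trans (by simpa using carriedSeminorm_smul_le hφ hg (-1) x)
    rwa [map_neg] at h
  refine ⟨ψ.mkContinuous ‖φ‖ fun x => (habs x).trans (ciSup_le fun m => ?_), ?_, habs⟩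
  · refine (StrongDual.apply_mono hφ inf_le_left).trans ((Real.le_norm_self _).trans ?_)
    simpa only [norm_abs_eq_norm] using φ.le_opNorm |x|
  · have := hψ ⟨f, Submodule.mem_span_singleton_self f⟩
    rw [LinearPMap.mkSpanSingleton_apply] at this
    exact hgp.trans this.ge

theorem IsDisjointSeq.abs {G : Type*} [AddCommGroup G] [Lattice G] [IsOrderedAddMonoid G]
    {x : ℕ → G} (hd : IsDisjointSeq x) : IsDisjointSeq fun n => |x n| := fun m n h => by
  simpa only [abs_abs] using hd m n h

/-- A positive disjoint sequence in the solid hull of a weakly null sequence is weakly null. -/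
theorem IsWeaklyNull.of_disjoint_of_le_abs {f g : ℕ → X} (hf : IsWeaklyNull f)
    (hg : ∀ n, 0 ≤ g n) (hgf : ∀ n, g n ≤ |f n|) (hd : IsDisjointSeq g) : IsWeaklyNull g := by
  intro φ
  have hφ : 0 ≤ |φ| := abs_nonneg φ
  choose ψ hψf hψ using fun n => exists_dual_le_carriedSeminorm hφ (hg n) (hgf n)
  have hlim := hf.tendsto_apply_of_sum_abs_le (ψ := ψ) (C := ‖φ‖) fun x s =>
    (Finset.sum_le_sum fun n _ => hψ n x).trans ((sum_carriedSeminorm_le hφ hg hd x s).trans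
      (by simpa only [norm_abs_eq_norm] using StrongDual.abs_apply_le_norm φ (abs_nonneg x)))
  refine squeeze_zero_norm (fun n => ?_) hlim
  refine (StrongDual.abs_apply_le φ (g n)).trans ?_
  rw [abs_of_nonneg (hg n)]
  exact hψf n

theorem IsWeaklyNull.abs_of_disjoint {x : ℕ → X} (hx : IsWeaklyNull x) (hd : IsDisjointSeq x) :
    IsWeaklyNull fun n => |x n| :=
  hx.of_disjoint_of_le_abs (fun _ => abs_nonneg _) (fun _ => le_rfl) hd.abs

end Disjoint

/-! ### Disjointification in the dual -/

section Disjointification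

variable {F : Type*} [NormedAddCommGroup F] [NormedSpace ℝ F] [Lattice F] [IsOrderedAddMonoid F]
  [IsOrderedModule ℝ F] [HasSolidNorm F]

/-- For `1 ≤ w`, the positive parts of `a - w b` and `b - w⁻¹ a` are disjoint. -/
theorem inf_posPart_eq_zero_of_le {X : Type*} [AddCommGroup X] [Module ℝ X] [Lattice X]
    [IsOrderedAddMonoid X] [IsOrderedModule ℝ X] {a b c d : X} {w : ℝ} (hw : 1 ≤ w)
    (hc : c ≤ a - w • b) (hd : d ≤ b - w⁻¹ • a) : c⁺ ⊓ d⁺ = 0 := by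
  have hw0 : 0 < w := one_pos.trans_le hw
  refine le_antisymm ?_ (le_inf (posPart_nonneg _) (posPart_nonneg _))
  have h₁ : c⁺ ≤ (w • b - a)⁻ := by
    rw [← posPart_neg, neg_sub]
    exact posPart_mono hc
  have h₂ : d⁺ ≤ (w • b - a)⁺ := by
    refine sup_le (hd.trans ?_) (posPart_nonneg _)
    rw [show b - w⁻¹ • a = w⁻¹ • (w • b - a) by rw [smul_sub, inv_smul_smul₀ hw0.ne']]
    refine (smul_le_smul_of_nonneg_left (le_posPart _) (inv_nonneg.mpr hw0.le)).trans ?_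
    exact smul_le_of_le_one_left (posPart_nonneg _) (inv_le_one_of_one_le₀ hw)
  calc c⁺ ⊓ d⁺ ≤ (w • b - a)⁻ ⊓ (w • b - a)⁺ := inf_le_inf h₁ h₂
    _ = 0 := by rw [inf_comm, posPart_inf_negPart_eq_zero]

/-- A positive weakly null sequence `y` whose subsequences are annihilated in the limit by every
weakly null sequence of functionals is also annihilated by the moduli of such sequences. If
`|fₙ| yₙ` stayed large, a disjointification of a subsequence of `|fₙ|` would be a weakly null
sequence of functionals violating the hypothesis. -/
theorem tendsto_abs_apply_of_isWeaklyNull {f : ℕ → StrongDual ℝ F} {y : ℕ → F}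
    (hf : IsWeaklyNull f) (hy : IsWeaklyNull y) (hy0 : ∀ n, 0 ≤ y n)
    (H : ∀ (g : ℕ → StrongDual ℝ F) (φ : ℕ → ℕ), StrictMono φ → IsWeaklyNull g →
      Tendsto (fun j => g j (y (φ j))) atTop (𝓝 0)) :
    Tendsto (fun n => |f n| (y n)) atTop (𝓝 0) := by
  by_contra hcon
  rw [Metric.tendsto_atTop] at hcon
  push Not at hcon
  obtain ⟨ε, hε, hcon⟩ := hcon
  have hfreq : ∃ᶠ n in atTop, ε ≤ |f n| (y n) := by
    rw [frequently_atTop]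
    intro N
    obtain ⟨n, hn, h⟩ := hcon N
    have h0 : 0 ≤ |f n| (y n) := (abs_nonneg (f n) : 0 ≤ |f n|) _ (hy0 n)
    rw [Real.dist_0_eq_abs, abs_of_nonneg h0] at h
    exact ⟨n, hn, h⟩
  obtain ⟨C, hC⟩ := hf.exists_norm_le
  -- pairs `(k, n)` of an exponent for the weights and an index of the sequence
  obtain ⟨p, hp, hp'⟩ := exists_seq_of_forall_finset_exists
    (fun q : ℕ × ℕ => ε ≤ |f q.2| (y q.2))
    (fun q r => q.1 < r.1 ∧ q.2 < r.2 ∧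
      2 ^ (q.1 + r.1) * |f q.2| (y r.2) ≤ ε / 8 * (1 / 2) ^ q.1) fun s _ => by
      let k := s.sup Prod.fst + 1
      have hev : ∀ q ∈ s, ∀ᶠ n in atTop, q.1 < k ∧ q.2 < n ∧
          2 ^ (q.1 + k) * |f q.2| (y n) ≤ ε / 8 * (1 / 2) ^ q.1 := fun q hq => by
        have h₁ := (hy |f q.2|).const_mul ((2 : ℝ) ^ (q.1 + k))
        rw [mul_zero] at h₁
        have h₂ : q.1 < k := Nat.lt_succ_of_le (Finset.le_sup (f := Prod.fst) hq)
        exact (Eventually.of_forall fun _ => h₂).and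
          ((eventually_gt_atTop q.2).and (h₁.eventually_le_const (by positivity)))
      obtain ⟨n, hn, hn'⟩ := (hfreq.and_eventually ((eventually_all_finset s).mpr hev)).exists
      exact ⟨(k, n), hn, hn'⟩
  have hk : StrictMono fun j => (p j).1 := fun i j h => (hp' i j h).1
  have hn : StrictMono fun j => (p j).2 := fun i j h => (hp' i j h).2.1
  let h : ℕ → StrongDual ℝ F := fun j => |f (p j).2|
  have hh0 : ∀ j, 0 ≤ h j := fun j => abs_nonneg _
  have hhC : ∀ j, ‖h j‖ ≤ C := fun j => (norm_abs_eq_norm _).trans_le (hC _)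
  -- `S = ∑ 2^(-kⱼ) hⱼ` dominates a multiple of every `hⱼ`
  have hterm0 : ∀ j, 0 ≤ (1 / 2 : ℝ) ^ (p j).1 • h j := fun j =>
    smul_nonneg (by positivity) (hh0 j)
  have hs : Summable fun j => (1 / 2 : ℝ) ^ (p j).1 • h j := by
    refine .of_norm_bounded (summable_geometric_two.mul_right C) fun j => ?_
    rw [norm_smul, norm_pow, Real.norm_of_nonneg (by norm_num : (0 : ℝ) ≤ 1 / 2)]
    exact mul_le_mul (pow_le_pow_of_le_one (by norm_num) (by norm_num) hk.le_apply) (hhC j)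
      (norm_nonneg _) (by positivity)
  obtain ⟨S, hS⟩ := hs
  have hS0 : 0 ≤ S := hS.nonneg hterm0
  have hSle : ∀ j, (1 / 2 : ℝ) ^ (p j).1 • h j ≤ S := fun j =>
    le_hasSum hS j fun i _ => hterm0 i
  -- for `i < j`, the weight `2^(kᵢ + kⱼ)` of `hᵢ` in `G j` is inverse to the one of `hⱼ` that the
  -- term `2^(-kᵢ) S` contributes to `G i`, which makes the positive parts disjoint
  let G : ℕ → StrongDual ℝ F := fun j =>
    h j - (∑ i ∈ Finset.range j, (2 : ℝ) ^ ((p i).1 + (p j).1) • h i) - (1 / 2 : ℝ) ^ (p j).1 • S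
  have hw0 : ∀ i j, 0 ≤ (2 : ℝ) ^ ((p i).1 + (p j).1) • h i := fun i j =>
    smul_nonneg (by positivity) (hh0 i)
  have hS0' : ∀ j, 0 ≤ (1 / 2 : ℝ) ^ (p j).1 • S := fun j => smul_nonneg (by positivity) hS0
  have hsum0 : ∀ j, 0 ≤ ∑ i ∈ Finset.range j, (2 : ℝ) ^ ((p i).1 + (p j).1) • h i := fun j =>
    Finset.sum_nonneg fun i _ => hw0 i j
  have hGh : ∀ j, G j ≤ h j := fun j =>
    (sub_le_self _ (hS0' j)).trans (sub_le_self _ (hsum0 j))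
  have hdisj : ∀ i j, i < j → (G j)⁺ ⊓ (G i)⁺ = 0 := fun i j hij => by
    refine inf_posPart_eq_zero_of_le (a := h j) (b := h i) (w := 2 ^ ((p i).1 + (p j).1))
      (one_le_pow₀ one_le_two) ?_ ?_
    · refine (sub_le_self _ (hS0' j)).trans (sub_le_sub_left ?_ _)
      exact Finset.single_le_sum (f := fun i => (2 : ℝ) ^ ((p i).1 + (p j).1) • h i)
        (fun i _ => hw0 i j) (Finset.mem_range.mpr hij)
    · refine sub_le_sub (sub_le_self _ (hsum0 i)) ?_
      rw [← inv_pow, inv_eq_one_div, pow_add, mul_smul]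
      exact smul_le_smul_of_nonneg_left (hSle j) (by positivity)
  have hdisj' : IsDisjointSeq fun j => (G j)⁺ := fun i j hij => by
    simp only [abs_of_nonneg (posPart_nonneg _)]
    rcases hij.lt_or_gt with hlt | hlt
    · rw [inf_comm]; exact hdisj i j hlt
    · exact hdisj j i hlt
  have hnull : IsWeaklyNull fun j => (G j)⁺ :=
    (hf.comp hn).of_disjoint_of_le_abs (fun j => posPart_nonneg _)
      (fun j => sup_le (hGh j) (hh0 j)) hdisj'
  have hlow : ∀ j, ε - ε / 4 - |S (y (p j).2)| ≤ (G j)⁺ (y (p j).2) := fun j => by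
    have h₁ : G j (y (p j).2) ≤ (G j)⁺ (y (p j).2) := le_posPart (G j) _ (hy0 _)
    have h₂ : ∑ i ∈ Finset.range j, (2 : ℝ) ^ ((p i).1 + (p j).1) * h i (y (p j).2) ≤ ε / 4 :=
      calc _ ≤ ∑ i ∈ Finset.range j, ε / 8 * (1 / 2) ^ i :=
            Finset.sum_le_sum fun i hi => (hp' i j (Finset.mem_range.mp hi)).2.2.trans
              (mul_le_mul_of_nonneg_left
                (pow_le_pow_of_le_one (by norm_num) (by norm_num) hk.le_apply) (by positivity))
        _ ≤ ε / 8 * 2 := by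
            rw [← Finset.mul_sum]
            exact mul_le_mul_of_nonneg_left (sum_geometric_two_le j) (by positivity)
        _ = ε / 4 := by ring
    have h₃ : (1 / 2 : ℝ) ^ (p j).1 * S (y (p j).2) ≤ |S (y (p j).2)| :=
      (mul_le_mul_of_nonneg_left (le_abs_self _) (by positivity)).trans
        (mul_le_of_le_one_left (abs_nonneg _) (pow_le_one₀ (by norm_num) (by norm_num)))
    have h₄ : G j (y (p j).2) = h j (y (p j).2) -
        ∑ i ∈ Finset.range j, (2 : ℝ) ^ ((p i).1 + (p j).1) * h i (y (p j).2) -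
        (1 / 2 : ℝ) ^ (p j).1 * S (y (p j).2) := by
      simp [G, sum_apply]
    have h₅ : ε ≤ h j (y (p j).2) := hp j
    linarith
  have hlim := H _ _ hn hnull
  have hlimS := (((hy.comp hn) S).abs).const_sub (ε - ε / 4)
  rw [abs_zero, sub_zero] at hlimS
  have := le_of_tendsto_of_tendsto' hlimS hlim hlow
  linarith

end Disjointification

/-! ### Almost Dunford–Pettis and almost weak Dunford–Pettis operators -/

section DunfordPettis

variable {E F : Type*} [NormedAddCommGroup E] [NormedSpace ℝ E] [Lattice E]
  [NormedAddCommGroup F] [NormedSpace ℝ F]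

theorem isClosed_almostDunfordPettis :
    IsClosed (almostDunfordPettis E F : Set (E →L[ℝ] F)) := by
  refine isClosed_of_closure_subset fun T hT x hd hx => ?_
  obtain ⟨C, hC⟩ := hx.exists_norm_le
  have hC0 : 0 ≤ C := (norm_nonneg _).trans (hC 0)
  rw [Metric.tendsto_atTop]
  intro ε hε
  obtain ⟨S, hS, hST⟩ := Metric.mem_closure_iff.mp hT (ε / (2 * (C + 1))) (by positivity)
  obtain ⟨N, hN⟩ := Metric.tendsto_atTop.mp (hS x hd hx) (ε / 2) (by positivity)
  refine ⟨N, fun n hn => ?_⟩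
  have h₁ := hN n hn
  have h₂ : ‖(T - S) (x n)‖ ≤ ε / 2 := by
    rw [dist_eq_norm, lt_div_iff₀ (by positivity)] at hST
    have := ((T - S).le_opNorm (x n)).trans (mul_le_mul_of_nonneg_left (hC n) (norm_nonneg _))
    nlinarith [norm_nonneg (T - S)]
  have h₃ := norm_add_le ((T - S) (x n)) (S (x n))
  rw [sub_apply, sub_add_cancel] at h₃
  rw [Real.dist_0_eq_abs, abs_norm] at h₁ ⊢
  rw [sub_apply] at h₂
  linarith

theorem isClosed_almostWeakDunfordPettis :
    IsClosed (almostWeakDunfordPettis E F : Set (E →L[ℝ] F)) := by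
  refine isClosed_of_closure_subset fun T hT f x hf hd hx => ?_
  obtain ⟨C, hC⟩ := hx.exists_norm_le
  obtain ⟨D, hD⟩ := hf.exists_norm_le
  have hC0 : 0 ≤ C := (norm_nonneg _).trans (hC 0)
  have hD0 : 0 ≤ D := (norm_nonneg _).trans (hD 0)
  rw [Metric.tendsto_atTop]
  intro ε hε
  obtain ⟨S, hS, hST⟩ := Metric.mem_closure_iff.mp hT (ε / (2 * (D * C + 1))) (by positivity)
  obtain ⟨N, hN⟩ := Metric.tendsto_atTop.mp (hS f x hf hd hx) (ε / 2) (by positivity)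
  refine ⟨N, fun n hn => ?_⟩
  have h₁ := hN n hn
  have h₂ : |f n ((T - S) (x n))| ≤ ε / 2 := by
    rw [dist_eq_norm, lt_div_iff₀ (by positivity)] at hST
    have h := ((T - S).le_opNorm (x n)).trans (mul_le_mul_of_nonneg_left (hC n) (norm_nonneg _))
    have h' : |f n ((T - S) (x n))| ≤ D * (‖T - S‖ * C) :=
      ((f n).le_opNorm _).trans (mul_le_mul (hD n) h (norm_nonneg _) hD0)
    nlinarith [norm_nonneg (T - S)]
  have h₃ := abs_add_le (f n ((T - S) (x n))) (f n (S (x n)))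
  rw [← map_add, sub_apply, sub_add_cancel] at h₃
  rw [Real.dist_0_eq_abs] at h₁ ⊢
  rw [sub_apply] at h₂
  linarith

variable [IsOrderedAddMonoid E] [IsOrderedModule ℝ E] [HasSolidNorm E]
  [Lattice F] [IsOrderedAddMonoid F] [HasSolidNorm F]

theorem mem_almostDunfordPettis_of_opLE {S T : E →L[ℝ] F} (hS : OpLE 0 S) (hST : OpLE S T)
    (hT : T ∈ almostDunfordPettis E F) : S ∈ almostDunfordPettis E F := fun x hd hx =>
  squeeze_zero (fun _ => norm_nonneg _)
    (fun n => norm_le_norm_of_abs_le_abs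
      ((abs_apply_le_of_nonneg_of_opLE hS hST (x n)).trans (le_abs_self _)))
    (hT (fun n => |x n|) hd.abs (hx.abs_of_disjoint hd))

theorem mem_almostWeakDunfordPettis_of_opLE [IsOrderedModule ℝ F] {S T : E →L[ℝ] F}
    (hS : OpLE 0 S) (hST : OpLE S T) (hT : T ∈ almostWeakDunfordPettis E F) :
    S ∈ almostWeakDunfordPettis E F := by
  intro f x hf hd hx
  have hxa := hx.abs_of_disjoint hd
  have hT0 : ∀ n, 0 ≤ T |x n| := fun n =>
    (hS _ (abs_nonneg _)).trans (hST _ (abs_nonneg _))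
  have hlim := tendsto_abs_apply_of_isWeaklyNull hf (hxa.map T) hT0 fun g φ hφ hg =>
    hT g (fun j => |x (φ j)|) hg (fun i j hij => hd.abs _ _ (hφ.injective.ne hij)) (hxa.comp hφ)
  refine squeeze_zero_norm (fun n => ?_) hlim
  exact (StrongDual.abs_apply_le (f n) (S (x n))).trans
    (StrongDual.apply_mono (abs_nonneg (f n)) (abs_apply_le_of_nonneg_of_opLE hS hST (x n)))

end DunfordPettis

theorem mainTheorem4 {E F : Type*}
    [NormedAddCommGroup E] [NormedSpace ℝ E] [Lattice E] [IsOrderedAddMonoid E]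
    [IsOrderedModule ℝ E] [HasSolidNorm E] [CompleteSpace E]
    [NormedAddCommGroup F] [NormedSpace ℝ F] [Lattice F] [IsOrderedAddMonoid F]
    [IsOrderedModule ℝ F] [HasSolidNorm F] [CompleteSpace F]
    (hF : IsDedekindComplete F) :
    IsBanachLatticeNorm (regularlyP (almostDunfordPettis E F))
        (envelopingNorm (almostDunfordPettis E F)) ∧
      IsBanachLatticeNorm (regularlyP (almostWeakDunfordPettis E F))
        (envelopingNorm (almostWeakDunfordPettis E F)) :=
  ⟨isBanachLatticeNorm_envelopingNorm hF isClosed_almostDunfordPettis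
      fun _ _ hS hST hT => mem_almostDunfordPettis_of_opLE hS hST hT,
    isBanachLatticeNorm_envelopingNorm hF isClosed_almostWeakDunfordPettis
      fun _ _ hS hST hT => mem_almostWeakDunfordPettis_of_opLE hS hST hT⟩
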